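/- Let $(X,\to,d_A)$ be a metric transition system: $X$ and $A$ are sets, $\to\,\subseteq X\times A\times X$, and $d_A\colon A\times A\to[0,1]$ is a metric (no restriction on branching). Write $r\ominus s=\max\{0,r-s\}$ and $r\oplus s=\min\{r+s,1\}$; all suprema and infima are taken in $[0,1]$, so that $\sup\emptyset=0$ and $\inf\emptyset=1$. For $f\colon X\to[0,1]$ and $U\subseteq X$ let $\tilde f(U)=\sup_{x\in U}f(x)$. For $\mathcal F\subseteq[0,1]^X$ put $$\alpha_S(\mathcal F)(x,y)=\sup_{f\in\mathcal F}\bigl(f(x)\ominus f(y)\bigr),\qquad \alpha_T(\mathcal F)(U,V)=\sup_{f\in\mathcal F}\bigl(\tilde f(U)\ominus\tilde f(V)\bigr)$$ for $x,y\in X$ and $U,V\subseteq X$. For $a\in A$ let $$\bigcirc_a f(x)=\sup\{\min(1-d_A(b,a),\,f(x'))\mid x\xrightarrow{b}x'\},$$ let $\mathrm{cl}^{\mathrm{sh}}(\mathcal F)$ be the least superset of $\mathcal F$ closed under $f\mapsto f\oplus c$ and $f\mapsto f\ominus c$ for all $c\in[0,1]$, and define the monotone maps on $(\mathcal P([0,1]^X),\subseteq)$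 $$\lambda_T(\mathcal F)=\Bigl(\bigcup_{a\in A}\bigcirc_a[\mathrm{cl}^{\mathrm{sh}}(\mathcal F)]\Bigr)\cup\{1\},\qquad \lambda'(\mathcal F)=\Bigl(\bigcup_{a\in A}\bigcirc_a[\mathcal F]\Bigr)\cup\{1\},$$ where $1$ is the constant function $1$. For words $\sigma,\tau\in A^*$ let $d_{\mathrm{Tr}}(\sigma,\tau)=1$ if their lengths differ, and let it be the maximum of the letterwise $d_A$-distances otherwise ($0$ for two empty words). For $x\in X$ let $\hat\delta(x)=\{(\sigma,x')\mid x\xrightarrow{\sigma}x'\}\subseteq A^*\times X$, where $\xrightarrow{\sigma}$ is the extension of $\to$ to words, and $\hat\delta[U]=\bigcup_{x\in U}\hat\delta(x)$. For a function $d\colon Y\times Y\to[0,1]$ let $d_{\overrightarrow H}(P,Q)=\sup_{p\in P}\inf_{q\in Q}d(p,q)$ for $P,Q\subseteq Y$, and let $(d\otimes e)((y,z),(y',z'))=\max\{d(y,y'),e(z,z')\}$. Let $\mathcal G\subseteq[0,1]^X$, put $d_0=\alpha_S(\mathcal G)$, and assume that for every $\varepsilon>0$ and every $x\in X$ there is $g\in\mathcal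 G$ with $g(x)=1$ and $g(x)\ominus g(x')\ge d_0(x,x')-\varepsilon$ for all $x'\in X$. Let $\mu(\lambda_T\cup\mathcal G)$ denote the least fixpoint of $\mathcal F\mapsto\lambda_T(\mathcal F)\cup\mathcal G$, and similarly for $\lambda'$. Then for all $X_1,X_2\subseteq X$ $$\alpha_T\bigl(\mu(\lambda_T\cup\mathcal G)\bigr)(X_1,X_2)=(d_{\mathrm{Tr}}\otimes d_0)_{\overrightarrow H}\bigl(\hat\delta[X_1],\hat\delta[X_2]\bigr),$$ and likewise $$\alpha_T\bigl(\mu(\lambda'\cup\mathcal G)\bigr)(X_1,X_2)=(d_{\mathrm{Tr}}\otimes d_0)_{\overrightarrow H}\bigl(\hat\delta[X_1],\hat\delta[X_2]\bigr).$$ -/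

import Mathlib

universe u v

namespace TraceMetric

/-- The unit interval `[0,1]` with its complete lattice structure. -/
abbrev I : Type := unitInterval

/-- Truncated addition `r ⊕ s = min {r + s, 1}`. -/
noncomputable def oplus (r s : I) : I :=
  ⟨min ((r : ℝ) + s) 1, le_min (add_nonneg r.2.1 s.2.1) zero_le_one, min_le_right _ _⟩

/-- Truncated subtraction `r ⊖ s = max {0, r - s}`. -/
noncomputable def ominus (r s : I) : I :=
  ⟨max 0 ((r : ℝ) - s), le_max_left _ _,
    max_le zero_le_one (by linarith [r.2.2, s.2.1])⟩

/-- A metric with values in `[0,1]`. -/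
structure IsMetric {A : Type v} (d : A → A → I) : Prop where
  self : ∀ a, d a a = 0
  eq_of_eq_zero : ∀ a b, d a b = 0 → a = b
  symm : ∀ a b, d a b = d b a
  triangle : ∀ a b c, d a c ≤ oplus (d a b) (d b c)

/-- A metric transition system with state space `X` over the alphabet `A`. -/
structure MTS (X : Type u) (A : Type v) where
  /-- the transition relation; `trans x a x'` is `x -a-> x'` -/
  trans : X → A → X → Prop
  /-- the metric on the alphabet -/
  dA : A → A → I
  isMetric : IsMetric dA

/-- The successors `δ(x) = {(a, x') | x -a-> x'}` of a state. -/
def MTS.delta {X : Type u} {A : Type v} (M : MTS X A) (x : X) : Set (A × X) :=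
  {p | M.trans x p.1 p.2}

/-- `M.steps x σ x'` is `x -σ-> x'`, for a word `σ`. -/
def MTS.steps {X : Type u} {A : Type v} (M : MTS X A) : X → List A → X → Prop
  | x, [], x' => x = x'
  | x, a :: σ, x' => ∃ y, M.trans x a y ∧ M.steps y σ x'

/-- `δ̂(x) = {(σ, x') | x -σ-> x'}`, the extension of `δ` to words. -/
def MTS.deltaHat {X : Type u} {A : Type v} (M : MTS X A) (x : X) : Set (List A × X) :=
  {p | M.steps x p.1 p.2}

/-- `δ̂[U] = ⋃ x ∈ U, δ̂(x)` for a set `U` of states. -/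
def MTS.deltaHatSet {X : Type u} {A : Type v} (M : MTS X A) (U : Set X) : Set (List A × X) :=
  ⋃ x ∈ U, M.deltaHat x

/-- The distance of two words induced by a distance of letters: `1` for words of different
lengths, and the maximum of the distances of the letters for words of the same length. -/
noncomputable def traceDist {A : Type v} (d : A → A → I) : List A → List A → I
  | [], [] => 0
  | a :: σ, b :: τ => max (d a b) (traceDist d σ τ)
  | [], _ :: _ => 1
  | _ :: _, [] => 1

/-- The product distance `d ⊗ e`. -/
noncomputable def prodDist {Y : Type u} {Z : Type v} (d : Y → Y → I) (e : Z → Z → I) :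
    Y × Z → Y × Z → I :=
  fun p q => max (d p.1 q.1) (e p.2 q.2)

/-- The directed Hausdorff lifting `d_H(U, V) = sup_{x ∈ U} inf_{y ∈ V} d(x, y)`, where sup and
inf are taken in `[0,1]`. -/
noncomputable def dirHausdorff {Y : Type u} (d : Y → Y → I) (U V : Set Y) : I :=
  ⨆ x ∈ U, ⨅ y ∈ V, d x y

/-- The join-preserving extension of `f` to sets, `f̃(U) = sup_{x ∈ U} f(x)`. -/
noncomputable def tilde {X : Type u} (f : X → I) (U : Set X) : I :=
  ⨆ x ∈ U, f x

/-- `α_S(F)(x, y) = sup_{f ∈ F} (f(x) ⊖ f(y))`. -/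
noncomputable def alphaS {X : Type u} (F : Set (X → I)) (x y : X) : I :=
  ⨆ f ∈ F, ominus (f x) (f y)

/-- `α_T(F)(U, V) = sup_{f ∈ F} (f̃(U) ⊖ f̃(V))`. -/
noncomputable def alphaT {X : Type u} (F : Set (X → I)) (U V : Set X) : I :=
  ⨆ f ∈ F, ominus (tilde f U) (tilde f V)

/-- The modality `○_a f (x) = sup {(1 - d_A(b, a)) ∧ f(x') | x -b-> x'}`. -/
noncomputable def MTS.next {X : Type u} {A : Type v} (M : MTS X A) (a : A) (f : X → I) : X → I :=
  fun x => ⨆ p ∈ M.delta x, unitInterval.symm (M.dA p.1 a) ⊓ f p.2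

/-- The closure under constant shifts: the least superset of `F` closed under `f ↦ f ⊕ c` and
`f ↦ f ⊖ c` for `c ∈ [0,1]`. -/
inductive shiftClosure {X : Type u} (F : Set (X → I)) : Set (X → I)
  | base (f : X → I) : f ∈ F → shiftClosure F f
  | add (f : X → I) (c : I) : shiftClosure F f → shiftClosure F (fun x => oplus (f x) c)
  | sub (f : X → I) (c : I) : shiftClosure F f → shiftClosure F (fun x => ominus (f x) c)

theorem shiftClosure_mono {X : Type u} : Monotone (shiftClosure (X := X)) := by
  intro F G h f hf
  induction hf with
  | base f hf => exact .base f (h hf)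
  | add f c _ ih => exact .add f c ih
  | sub f c _ ih => exact .sub f c ih

/-- The trace logic function without shifts, `F ↦ (⋃ a, ○_a[F]) ∪ {1}`. -/
noncomputable def MTS.logNoShift {X : Type u} {A : Type v} (M : MTS X A) :
    Set (X → I) →o Set (X → I) where
  toFun F := (⋃ a : A, M.next a '' F) ∪ {1}
  monotone' _ _ h :=
    Set.union_subset_union_left _ (Set.iUnion_mono fun _ => Set.image_mono h)

/-- The trace logic function `F ↦ (⋃ a, ○_a[cl_sh(F)]) ∪ {1}`. -/
noncomputable def MTS.logT {X : Type u} {A : Type v} (M : MTS X A) :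
    Set (X → I) →o Set (X → I) where
  toFun F := (⋃ a : A, M.next a '' shiftClosure F) ∪ {1}
  monotone' _ _ h :=
    Set.union_subset_union_left _
      (Set.iUnion_mono fun _ => Set.image_mono (shiftClosure_mono h))

/-- The logic function `F ↦ L(F) ∪ G`. -/
def withConst {X : Type u} (L : Set (X → I) →o Set (X → I)) (G : Set (X → I)) :
    Set (X → I) →o Set (X → I) where
  toFun F := L F ∪ G
  monotone' _ _ h := Set.union_subset_union_left _ (L.monotone h)

end TraceMetric

namespace TraceMetric

/-! Both least fixpoints are squeezed between two bounds, the shift-free one being contained in the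
other. Upper bound: every formula `f` of the larger fixpoint satisfies `f x ≤ f̃ V + t` whenever all
traces of `x` are matched below `t` from `V`. This invariant (`MTS.Nonexpansive`) holds for `1` and
on `G`, and survives shifts and modalities. Comparing a state with a set is essential: matching
traces may start in different elements of `V`, and stepping along a letter replaces `V` by a set of
successors. Lower bound: a trace `(σ, z)` from `U` is tested by `○_σ g`, where `g ∈ G` has `g z = 1`
and nearly realises `d₀(z, ·)`. The formula is `1` on `U`, while on `V` it is bounded through the
values `min (1 - d(τ, σ)) (g w)` over traces `(τ, w)`. No shifts are needed here. -/

theorem ominus_le_iff (r s t : I) : ominus r s ≤ t ↔ (r : ℝ) ≤ s + t := by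
  rw [← Subtype.coe_le_coe]
  simp only [ominus, max_le_iff]
  constructor
  · intro h; linarith [h.2]
  · intro h; exact ⟨t.2.1, by linarith⟩

theorem le_oplus_iff (r s t : I) : r ≤ oplus s t ↔ (r : ℝ) ≤ s + t := by
  rw [← Subtype.coe_le_coe]
  simp only [oplus, le_min_iff]
  exact ⟨fun h => h.1, fun h => ⟨h, r.2.2⟩⟩

theorem le_tilde {X : Type u} (f : X → I) {U : Set X} {x : X} (hx : x ∈ U) :
    f x ≤ tilde f U :=
  le_iSup₂ (f := fun x (_ : x ∈ U) => f x) x hx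

theorem tilde_le {X : Type u} {f : X → I} {U : Set X} {c : I} (h : ∀ x ∈ U, f x ≤ c) :
    tilde f U ≤ c :=
  iSup₂_le h

theorem traceDist_symm {A : Type v} {d : A → A → I} (hd : ∀ a b, d a b = d b a) :
    ∀ σ τ : List A, traceDist d σ τ = traceDist d τ σ
  | [], [] => rfl
  | [], _ :: _ => rfl
  | _ :: _, [] => rfl
  | a :: σ, b :: τ => by simp only [traceDist, hd a b, traceDist_symm hd σ τ]

variable {X : Type u} {A : Type v}

theorem MTS.mem_deltaHatSet (M : MTS X A) (U : Set X) (σ : List A) (z : X) :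
    (σ, z) ∈ M.deltaHatSet U ↔ ∃ x ∈ U, M.steps x σ z := by
  simp [MTS.deltaHatSet, MTS.deltaHat]

theorem MTS.le_next (M : MTS X A) (a : A) (f : X → I) {x x' : X} {b : A}
    (h : M.trans x b x') : unitInterval.symm (M.dA b a) ⊓ f x' ≤ M.next a f x :=
  le_iSup₂ (f := fun (p : A × X) (_ : p ∈ M.delta x) =>
    unitInterval.symm (M.dA p.1 a) ⊓ f p.2) (b, x') h

theorem MTS.next_le (M : MTS X A) {a : A} {f : X → I} {x : X} {c : I}
    (h : ∀ b x', M.trans x b x' → unitInterval.symm (M.dA b a) ⊓ f x' ≤ c) :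
    M.next a f x ≤ c :=
  iSup₂_le fun p hp => h p.1 p.2 hp

/-! ### Upper bound: matched traces and nonexpansive formulas -/

/-- Every trace from `x` is matched by a trace from `V` at distance less than `t`. -/
def MTS.Matched (M : MTS X A) (d : X → X → I) (t : I) (x : X) (V : Set X) : Prop :=
  ∀ σ z, M.steps x σ z → ∃ y ∈ V, ∃ τ w, M.steps y τ w ∧
    traceDist M.dA σ τ < t ∧ d z w < t

/-- Matched traces bound the difference of the values of `f`. -/
def MTS.Nonexpansive (M : MTS X A) (d : X → X → I) (f : X → I) : Prop :=
  ∀ t x V, M.Matched d t x V → (f x : ℝ) ≤ tilde f V + t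

/-- Only the empty word is closer than `t ≤ 1` to the empty word. In particular `V` is nonempty. -/
theorem MTS.Matched.exists_dist_lt {M : MTS X A} {d : X → X → I} {t : I} {x : X} {V : Set X}
    (h : M.Matched d t x V) : ∃ y ∈ V, d x y < t := by
  obtain ⟨y, hy, τ, w, hw, h₁, h₂⟩ := h [] x rfl
  cases τ with
  | nil => cases hw; exact ⟨y, hy, h₂⟩
  | cons b τ => exact absurd h₁ (not_lt_of_ge t.2.2)

theorem MTS.Matched.of_trans {M : MTS X A} {d : X → X → I} {t : I} {x x' : X} {V : Set X}
    (h : M.Matched d t x V) {b : A} (hx : M.trans x b x') :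
    M.Matched d t x' {y' | ∃ y ∈ V, ∃ b', M.trans y b' y' ∧ M.dA b b' < t} := by
  intro σ z hz
  obtain ⟨y, hy, τ, w, hw, h₁, h₂⟩ := h (b :: σ) z ⟨x', hx, hz⟩
  cases τ with
  | nil => exact absurd h₁ (not_lt_of_ge t.2.2)
  | cons b' τ =>
    obtain ⟨y', hy', hw⟩ := hw
    simp only [traceDist, max_lt_iff] at h₁
    exact ⟨y', ⟨y, hy, b', hy', h₁.1⟩, τ, w, hw, h₁.2, h₂⟩

theorem MTS.nonexpansive_one (M : MTS X A) (d : X → X → I) : M.Nonexpansive d 1 := by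
  intro t x V h
  obtain ⟨y, hy, -⟩ := h.exists_dist_lt
  have h₁ : ((1 : X → I) y : ℝ) ≤ tilde 1 V := Subtype.coe_le_coe.2 (le_tilde 1 hy)
  have h₂ : ((1 : X → I) x : ℝ) = (1 : X → I) y := rfl
  linarith [t.2.1]

theorem MTS.nonexpansive_of_le_dist (M : MTS X A) {d : X → X → I} {f : X → I}
    (hf : ∀ x y, ominus (f x) (f y) ≤ d x y) : M.Nonexpansive d f := by
  intro t x V h
  obtain ⟨y, hy, hd⟩ := h.exists_dist_lt
  have h₁ : (f y : ℝ) ≤ tilde f V := le_tilde f hy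
  have h₂ := (ominus_le_iff _ _ _).1 (hf x y)
  have h₃ : (d x y : ℝ) < t := hd
  linarith

theorem MTS.Nonexpansive.oplus {M : MTS X A} {d : X → X → I} {f : X → I}
    (hf : M.Nonexpansive d f) (c : I) : M.Nonexpansive d fun x => oplus (f x) c := by
  intro t x V h
  obtain ⟨y, hy, -⟩ := h.exists_dist_lt
  have hxt := hf t x V h
  set T := tilde (fun x => TraceMetric.oplus (f x) c) V with hT
  have key : ∀ y ∈ V, min ((f y : ℝ) + c) 1 ≤ T := fun y hy =>
    Subtype.coe_le_coe.2 (le_tilde (fun x => TraceMetric.oplus (f x) c) hy)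
  change min ((f x : ℝ) + c) 1 ≤ T + t
  -- If `T < 1`, the cut-off at `1` is inactive on all of `V`, so the shift by `c` can be undone.
  -- Here `c ≤ T` needs a point of `V`, as the supremum over the empty set is `0`.
  rcases T.2.2.lt_or_eq with h1 | h1
  · have hle : tilde f V ≤ ominus T c := tilde_le fun y hy => by
      have := key y hy
      rw [min_le_iff] at this
      rw [← Subtype.coe_le_coe]
      refine le_max_of_le_right ?_
      rcases this with h | h <;> linarith
    have hcT : (c : ℝ) ≤ T := by
      have := key y hy
      rw [min_le_iff] at this
      rcases this with h | h <;> linarith [(f y).2.1]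
    have hle' : (tilde f V : ℝ) ≤ max 0 ((T : ℝ) - c) := hle
    rw [max_eq_right (by linarith)] at hle'
    exact (min_le_left _ _).trans (by linarith)
  · exact (min_le_right _ _).trans (by linarith [t.2.1])

theorem MTS.Nonexpansive.ominus {M : MTS X A} {d : X → X → I} {f : X → I}
    (hf : M.Nonexpansive d f) (c : I) : M.Nonexpansive d fun x => ominus (f x) c := by
  intro t x V h
  have hxt := hf t x V h
  set T := tilde (fun x => TraceMetric.ominus (f x) c) V with hT
  have hle : tilde f V ≤ TraceMetric.oplus T c := tilde_le fun y hy => by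
    have := (ominus_le_iff _ _ _).1 (le_tilde (fun x => TraceMetric.ominus (f x) c) hy)
    rw [le_oplus_iff]
    linarith
  rw [le_oplus_iff] at hle
  change max 0 ((f x : ℝ) - c) ≤ T + t
  exact max_le (add_nonneg T.2.1 t.2.1) (by linarith)

theorem MTS.Nonexpansive.next {M : MTS X A} {d : X → X → I} {f : X → I}
    (hf : M.Nonexpansive d f) (a : A) : M.Nonexpansive d (M.next a f) := by
  intro t x V h
  set T := tilde (M.next a f) V with hT
  rw [← le_oplus_iff]
  refine M.next_le fun b x' hx => ?_
  -- If a letter `b'` near `b` has `1 - d(b', a) ≤ T`, the triangle inequality bounds the letter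
  -- part. Otherwise every near letter exceeds `T`, so the minimum in `○_a f` forces `f y' ≤ T` at
  -- all successors along near letters, and the invariant of `f` applies to that set.
  by_cases hc : ∃ y ∈ V, ∃ b' y', M.trans y b' y' ∧ M.dA b b' < t ∧
      unitInterval.symm (M.dA b' a) ≤ T
  · obtain ⟨y, hy, b', y', hy', hb, hle⟩ := hc
    refine inf_le_left.trans ?_
    rw [le_oplus_iff]
    have h₁ : (M.dA b' a : ℝ) ≤ M.dA b' b + M.dA b a :=
      (le_oplus_iff _ _ _).1 (M.isMetric.triangle b' b a)
    rw [M.isMetric.symm b' b] at h₁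
    have h₂ : 1 - (M.dA b' a : ℝ) ≤ T := hle
    have h₃ : (M.dA b b' : ℝ) < t := hb
    change 1 - (M.dA b a : ℝ) ≤ _
    linarith
  · push Not at hc
    refine inf_le_right.trans ?_
    rw [le_oplus_iff]
    have h₁ := hf t x' _ (h.of_trans hx)
    refine h₁.trans (add_le_add_left (Subtype.coe_le_coe.2 (tilde_le ?_)) _)
    rintro y' ⟨y, hy, b', hy', hb⟩
    have h₂ := (M.le_next a f hy').trans (le_tilde (M.next a f) hy)
    rcases inf_le_iff.1 h₂ with h₃ | h₃
    · exact absurd h₃ (not_le_of_gt (hc y hy b' y' hy' hb))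
    · exact h₃

theorem MTS.nonexpansive_of_mem_lfp (M : MTS X A) {G : Set (X → I)} {f : X → I}
    (hf : f ∈ OrderHom.lfp (withConst M.logT G)) : M.Nonexpansive (alphaS G) f := by
  suffices h : OrderHom.lfp (withConst M.logT G) ≤ {f | M.Nonexpansive (alphaS G) f} from h hf
  refine OrderHom.lfp_le _ ?_
  rintro f ((hf | rfl) | hf)
  · obtain ⟨a, g, hg, rfl⟩ := Set.mem_iUnion.1 hf
    refine MTS.Nonexpansive.next ?_ a
    clear hf
    induction hg with
    | base f hf => exact hf
    | add f c _ ih => exact ih.oplus c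
    | sub f c _ ih => exact ih.ominus c
  · exact M.nonexpansive_one _
  · exact M.nonexpansive_of_le_dist fun x y =>
      le_iSup₂ (f := fun f (_ : f ∈ G) => TraceMetric.ominus (f x) (f y)) f hf

theorem MTS.matched_of_dirHausdorff_lt (M : MTS X A) {d : X → X → I} {U V : Set X} {t : I}
    (h : dirHausdorff (prodDist (traceDist M.dA) d) (M.deltaHatSet U) (M.deltaHatSet V) < t)
    {x : X} (hx : x ∈ U) : M.Matched d t x V := by
  intro σ z hz
  have h₁ := (le_iSup₂ (f := fun p (_ : p ∈ M.deltaHatSet U) =>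
    ⨅ q ∈ M.deltaHatSet V, prodDist (traceDist M.dA) d p q) (σ, z)
    ((M.mem_deltaHatSet U σ z).2 ⟨x, hx, hz⟩)).trans_lt h
  simp only [iInf_lt_iff] at h₁
  obtain ⟨⟨τ, w⟩, hq, hlt⟩ := h₁
  obtain ⟨y, hy, hw⟩ := (M.mem_deltaHatSet V τ w).1 hq
  exact ⟨y, hy, τ, w, hw, max_lt_iff.1 hlt⟩

theorem MTS.alphaT_le_dirHausdorff (M : MTS X A) (G : Set (X → I)) (U V : Set X) :
    alphaT (OrderHom.lfp (withConst M.logT G)) U V ≤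
      dirHausdorff (prodDist (traceDist M.dA) (alphaS G))
        (M.deltaHatSet U) (M.deltaHatSet V) := by
  -- A strictly larger `t` is used because the infimum over matching traces need not be attained.
  refine iSup₂_le fun f hf => le_of_forall_gt_imp_ge_of_dense fun t ht => ?_
  rw [ominus_le_iff, ← le_oplus_iff]
  refine tilde_le fun x hx => ?_
  rw [le_oplus_iff]
  exact M.nonexpansive_of_mem_lfp hf t x V (M.matched_of_dirHausdorff_lt ht hx)

theorem MTS.lfp_logNoShift_le (M : MTS X A) (G : Set (X → I)) :
    OrderHom.lfp (withConst M.logNoShift G) ≤ OrderHom.lfp (withConst M.logT G) := by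
  refine OrderHom.lfp.monotone fun F => Set.union_subset_union_left _ ?_
  exact Set.union_subset_union_left _ (Set.iUnion_mono fun _ =>
    Set.image_mono fun f hf => .base f hf)

theorem alphaT_mono {F F' : Set (X → I)} (h : F ⊆ F') (U V : Set X) :
    alphaT F U V ≤ alphaT F' U V :=
  biSup_mono fun _ hf => h hf

/-! ### Lower bound: testing a trace by an iterated modality -/

/-- The iterated modality `○_{a₁} ⋯ ○_{aₙ} f` of a word `a₁ ⋯ aₙ`. -/
noncomputable def MTS.nextWord (M : MTS X A) (f : X → I) : List A → X → I
  | [] => f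
  | a :: σ => M.next a (M.nextWord f σ)

theorem MTS.nextWord_mem_lfp (M : MTS X A) {G : Set (X → I)} {g : X → I} (hg : g ∈ G)
    (σ : List A) : M.nextWord g σ ∈ OrderHom.lfp (withConst M.logNoShift G) := by
  rw [← OrderHom.map_lfp]
  cases σ with
  | nil => exact Or.inr hg
  | cons a σ =>
    exact Or.inl (Or.inl (Set.mem_iUnion.2 ⟨a, _, M.nextWord_mem_lfp hg σ, rfl⟩))

theorem MTS.nextWord_eq_one (M : MTS X A) {g : X → I} {z : X} (hg : g z = 1) :
    ∀ (σ : List A) (x : X), M.steps x σ z → M.nextWord g σ x = 1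
  | [], _, rfl => hg
  | a :: σ, x, ⟨y, hy, hz⟩ => by
    refine le_antisymm unitInterval.le_one' ?_
    refine le_trans ?_ (M.le_next a _ hy)
    rw [M.nextWord_eq_one hg σ y hz, M.isMetric.self]
    simp

/-- The order is linear, so at each letter either the letter part is already at most `c`, or it
drops out of the minimum in the hypothesis, leaving the hypothesis for the remaining word. -/
theorem MTS.nextWord_le (M : MTS X A) {g : X → I} {c : I} :
    ∀ (σ : List A) (x : X),
      (∀ τ w, M.steps x τ w → unitInterval.symm (traceDist M.dA τ σ) ⊓ g w ≤ c) →
      M.nextWord g σ x ≤ c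
  | [], x, h => by
    have h₁ := h [] x rfl
    rw [traceDist, unitInterval.symm_zero, inf_eq_right.2 unitInterval.le_one'] at h₁
    exact h₁
  | a :: σ, x, h => by
    refine M.next_le fun b y hy => ?_
    by_cases hb : unitInterval.symm (M.dA b a) ≤ c
    · exact inf_le_left.trans hb
    · refine inf_le_right.trans (M.nextWord_le σ y fun τ w hw => ?_)
      have h₁ := h (b :: τ) w ⟨y, hy, hw⟩
      rw [traceDist, unitInterval.strictAnti_symm.antitone.map_max, inf_assoc] at h₁
      exact (inf_le_iff.1 h₁).resolve_left hb

theorem MTS.dirHausdorff_le_alphaT (M : MTS X A) (G : Set (X → I))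
    (hG : ∀ ε : ℝ, 0 < ε → ∀ x : X, ∃ g ∈ G, g x = 1 ∧
      ∀ x' : X, (alphaS G x x' : ℝ) - ε ≤ (ominus (g x) (g x') : ℝ)) (U V : Set X) :
    dirHausdorff (prodDist (traceDist M.dA) (alphaS G)) (M.deltaHatSet U) (M.deltaHatSet V) ≤
      alphaT (OrderHom.lfp (withConst M.logNoShift G)) U V := by
  refine iSup₂_le ?_
  rintro ⟨σ, z⟩ hp
  obtain ⟨x, hx, hz⟩ := (M.mem_deltaHatSet U σ z).1 hp
  set m := ⨅ q ∈ M.deltaHatSet V, prodDist (traceDist M.dA) (alphaS G) (σ, z) q with hm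
  set s := alphaT (OrderHom.lfp (withConst M.logNoShift G)) U V with hs
  refine Subtype.coe_le_coe.1 (le_of_forall_pos_le_add fun ε hε => ?_)
  obtain ⟨g, hg, hgz, hgd⟩ := hG ε hε z
  have h₁ : ominus (tilde (M.nextWord g σ) U) (tilde (M.nextWord g σ) V) ≤ s :=
    le_iSup₂ (f := fun f (_ : f ∈ OrderHom.lfp (withConst M.logNoShift G)) =>
      ominus (tilde f U) (tilde f V)) _ (M.nextWord_mem_lfp hg σ)
  rw [ominus_le_iff] at h₁
  have h₂ : (1 : ℝ) ≤ tilde (M.nextWord g σ) U := by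
    have := le_tilde (M.nextWord g σ) hx
    rwa [M.nextWord_eq_one hgz σ x hz] at this
  have h₃ : tilde (M.nextWord g σ) V ≤
      -- Capping `ε` at `1` only serves to stay in `[0,1]`.
      oplus (unitInterval.symm m) ⟨min ε 1, le_min hε.le zero_le_one, min_le_right _ _⟩ := by
    refine tilde_le fun y hy => M.nextWord_le σ y fun τ w hw => ?_
    have h₄ : m ≤ max (traceDist M.dA σ τ) (alphaS G z w) :=
      iInf₂_le (f := fun q (_ : q ∈ M.deltaHatSet V) =>
        prodDist (traceDist M.dA) (alphaS G) (σ, z) q) (τ, w)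
        ((M.mem_deltaHatSet V τ w).2 ⟨y, hy, hw⟩)
    rw [le_oplus_iff]
    change _ ≤ 1 - (m : ℝ) + min ε 1
    rcases le_max_iff.1 h₄ with h₅ | h₅
    · have h₆ : (m : ℝ) ≤ traceDist M.dA τ σ := by
        rw [traceDist_symm M.isMetric.symm]; exact h₅
      have h₇ : ((unitInterval.symm (traceDist M.dA τ σ) ⊓ g w : I) : ℝ) ≤
        (unitInterval.symm (traceDist M.dA τ σ) : I) := Subtype.coe_le_coe.2 inf_le_left
      rw [unitInterval.coe_symm_eq] at h₇
      linarith [le_min hε.le zero_le_one]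
    · have h₆ : (m : ℝ) ≤ alphaS G z w := h₅
      have h₇ : ((unitInterval.symm (traceDist M.dA τ σ) ⊓ g w : I) : ℝ) ≤ g w :=
        Subtype.coe_le_coe.2 inf_le_right
      have h₈ : (alphaS G z w : ℝ) - ε ≤ max 0 ((g z : ℝ) - g w) := hgd w
      have h₉ : (g z : ℝ) = 1 := by rw [hgz]; rfl
      -- Since `g z = 1`, near-optimality of `g` reads `g w ≤ 1 - d₀(z, w) + ε`.
      rw [h₉, max_eq_right (by linarith [(g w).2.2])] at h₈
      rcases min_choice ε 1 with h | h <;> rw [h] <;> linarith [m.2.2, (g w).2.2]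
  rw [le_oplus_iff] at h₃
  change _ ≤ 1 - (m : ℝ) + min ε 1 at h₃
  linarith [min_le_left ε 1]

end TraceMetric

theorem mainTheorem3 {X : Type u} {A : Type v} (M : TraceMetric.MTS X A)
    (G : Set (X → TraceMetric.I)) (d0 : X → X → TraceMetric.I)
    (hd0 : d0 = TraceMetric.alphaS G)
    (hG : ∀ ε : ℝ, 0 < ε → ∀ x : X, ∃ g ∈ G, g x = 1 ∧
      ∀ x' : X, (d0 x x' : ℝ) - ε ≤ (TraceMetric.ominus (g x) (g x') : ℝ)) :
    (∀ X₁ X₂ : Set X,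
      TraceMetric.alphaT (OrderHom.lfp (TraceMetric.withConst M.logT G)) X₁ X₂ =
        TraceMetric.dirHausdorff
          (TraceMetric.prodDist (TraceMetric.traceDist M.dA) d0)
          (M.deltaHatSet X₁) (M.deltaHatSet X₂)) ∧
    (∀ X₁ X₂ : Set X,
      TraceMetric.alphaT (OrderHom.lfp (TraceMetric.withConst M.logNoShift G)) X₁ X₂ =
        TraceMetric.dirHausdorff
          (TraceMetric.prodDist (TraceMetric.traceDist M.dA) d0)
          (M.deltaHatSet X₁) (M.deltaHatSet X₂)) := by

  subst hd0
  have hle := M.alphaT_le_dirHausdorff G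
  have hge := M.dirHausdorff_le_alphaT G hG
  have hmono := TraceMetric.alphaT_mono (M.lfp_logNoShift_le G)
  exact ⟨fun U V => le_antisymm (hle U V) ((hge U V).trans (hmono U V)),
    fun U V => le_antisymm ((hmono U V).trans (hle U V)) (hge U V)⟩
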